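/- Let $\Sigma$ be a finite alphabet. The Parikh map $\Psi\colon\Sigma^*\to\mathbb N^\Sigma$ sends a word $w$ to $\Psi(w)=(|w|_a)_{a\in\Sigma}$, where $|w|_a$ is the number of occurrences of $a$ in $w$. A language $L\subseteq\Sigma^*$ is permutation-invariant if for all $u,v\in\Sigma^*$ with $\Psi(u)=\Psi(v)$ we have $u\in L\iff v\in L$. For $d\in\mathbb N$, a $d$-dimensional simplified multicounter machine is a tuple $M=(Q,\Sigma,q_0,\delta,u,F)$ with a finite set $Q$ of states, an initial state $q_0\in Q$, a transition function $\delta\colon Q\times\Sigma\times\{0,1\}^d\to Q$, a counter update function $u\colon\Sigma\to\{+1,-1,\cdot 0,\cdot 1\}^d$ and a set $F\subseteq Q\times\{0,1\}^d$. For $x\in\mathbb Z^d$ let $\operatorname{mask}(x)\in\{0,1\}^d$ be the vector with $\operatorname{mask}(x)_i=0$ if and only if $x_i=0$. The vector $u(a)$ acts on $\mathbb Z^d$ componentwise: it increments, decrements, resets to $0$, or leaves unchanged the $i$-th component according to whether $u(a)_i$ is $+1$, $-1$, $\cdot 0$ or $\cdot 1$. Reading a letter $a$ in the configuration $(p,x)\in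 Q\times\mathbb Z^d$, the machine moves to the configuration $(\delta(p,a,\operatorname{mask}(x)),\,u(a)(x))$. A word $w$ is accepted by $M$ if reading $w$ from the configuration $(q_0,0)$ leads to a configuration $(q,x)$ with $(q,\operatorname{mask}(x))\in F$, and the language accepted by $M$ is the set of all accepted words. Statement: if $L\subseteq\Sigma^*$ is permutation-invariant and is the language accepted by some simplified multicounter machine, then its Parikh image $\Psi(L)=\{\Psi(w)\mid w\in L\}\subseteq\mathbb N^\Sigma$ is semilinear, that is, a finite union of sets of the form $\{v_0+n_1v_1+\dots+n_kv_k\mid n_1,\dots,n_k\in\mathbb N\}$ with $k\in\mathbb N$ and $v_0,\dots,v_k\in\mathbb N^\Sigma$. -/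

import Mathlib

/-- The Parikh map: `parikh w a` is the number of occurrences of the letter `a` in the word `w`. -/
def parikh {α : Type*} [DecidableEq α] (w : List α) : α → ℕ :=
  fun a => w.count a

/-- A language is permutation-invariant if membership of a word depends only on its
Parikh vector. -/
def PermutationInvariant {α : Type*} [DecidableEq α] (L : Language α) : Prop :=
  ∀ u v : List α, parikh u = parikh v → (u ∈ L ↔ v ∈ L)

/-- The counter operations: increment (`+1`), decrement (`-1`), reset (`·0`) and
no-operation (`·1`). -/
inductive CounterOp : Type
  | inc : CounterOp
  | dec : CounterOp
  | reset : CounterOp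
  | nop : CounterOp

/-- The function on integers induced by a counter operation. -/
def CounterOp.apply : CounterOp → ℤ → ℤ
  | CounterOp.inc, x => x + 1
  | CounterOp.dec, x => x - 1
  | CounterOp.reset, _ => 0
  | CounterOp.nop, x => x

/-- The masking function `ℤ^d → {0,1}^d` (with `false` for `0` and `true` for `1`): a component
of the mask is `0` exactly if the corresponding component of the vector is `0`. -/
def counterMask {d : ℕ} (x : Fin d → ℤ) : Fin d → Bool :=
  fun i => decide (x i ≠ 0)

/-- A `d`-dimensional simplified multicounter machine with states `Q` and input alphabet `α`.
The update of the counters depends on the input letter only. -/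
structure SimplifiedMulticounterMachine (Q α : Type*) (d : ℕ) where
  /-- the initial state -/
  start : Q
  /-- the transition function -/
  trans : Q → α → (Fin d → Bool) → Q
  /-- the counter update function -/
  update : α → Fin d → CounterOp
  /-- the masked accepting configurations -/
  accept : Set (Q × (Fin d → Bool))

namespace SimplifiedMulticounterMachine

/-- One step of the machine: reading `a` leads from configuration `c` to configuration `c'`. -/
def Step {Q α : Type*} {d : ℕ} (M : SimplifiedMulticounterMachine Q α d) (a : α)
    (c c' : Q × (Fin d → ℤ)) : Prop :=
  c'.1 = M.trans c.1 a (counterMask c.2) ∧ ∀ i, c'.2 i = (M.update a i).apply (c.2 i)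

/-- `M.Run w c c'`: reading the word `w`, letter by letter from the left, leads from
configuration `c` to configuration `c'`. -/
inductive Run {Q α : Type*} {d : ℕ} (M : SimplifiedMulticounterMachine Q α d) :
    List α → Q × (Fin d → ℤ) → Q × (Fin d → ℤ) → Prop
  | nil (c : Q × (Fin d → ℤ)) : Run M [] c c
  | cons {a : α} {w : List α} {c c' c'' : Q × (Fin d → ℤ)}
      (hstep : M.Step a c c') (hrun : Run M w c' c'') : Run M (a :: w) c c''

/-- The language of the words accepted by the machine, starting with all counters at zero. -/
def acceptedLanguage {Q α : Type*} {d : ℕ} (M : SimplifiedMulticounterMachine Q α d) :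
    Language α :=
  {w | ∃ (q : Q) (x : Fin d → ℤ),
    M.Run w (M.start, fun _ => 0) (q, x) ∧ (q, counterMask x) ∈ M.accept}

end SimplifiedMulticounterMachine

/-! By permutation invariance, one run for each Parikh vector decides membership, so it suffices to
follow words that are products of blocks `a ^ n`, one block per letter. Inside a block each counter
undergoes a single fixed operation, so it switches between zero and nonzero at most twice. The block
thus splits into boundedly many phases of constant mask. In a phase the state iterates a fixed
self-map of a finite set, and the counters move in a Presburger-definable way, so the reachability
relation is semilinear. `Tracks` packages such relations and is closed under finite unions and
composition; `tracks_single_of_rank_lt` glues phases into a block and `tracks_of_forall_notMem`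
glues blocks. -/

/-- Orbits in a finite set are ultimately periodic, hence so are the hitting times. -/
theorem isSemilinearSet_iterate_eq {Q : Type*} [Finite Q] (f : Q → Q) (q q' : Q) :
    IsSemilinearSet {n : ℕ | f^[n] q = q'} := by
  obtain ⟨i, j, hij, h⟩ := Finite.exists_ne_map_eq_of_infinite fun n => f^[n] q
  wlog hlt : i < j generalizing i j
  · exact this j i hij.symm h.symm (by omega)
  rw [Nat.isSemilinearSet_iff_ultimately_periodic]
  refine ⟨i, j - i, by omega, fun x hx => ?_⟩
  obtain ⟨t, rfl⟩ := Nat.exists_eq_add_of_le' hx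
  have : t + i + (j - i) = t + j := by omega
  simp only [Set.mem_ofPred_eq, this, Function.iterate_add_apply]
  exact by rw [show f^[i] q = f^[j] q from h]

/-! ### Iterating one counter operation -/

namespace CounterOp

/-- A potential that does not increase under the operation, and drops whenever the operation
changes the mask. -/
def rank : CounterOp → ℤ → ℕ
  | inc, x => if x < 0 then 2 else if x = 0 then 1 else 0
  | dec, x => if 0 < x then 2 else if x = 0 then 1 else 0
  | reset, x => if x = 0 then 0 else 1
  | nop, _ => 0

theorem rank_le_two (o : CounterOp) (x : ℤ) : o.rank x ≤ 2 := by
  cases o <;> grind [rank]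

theorem rank_apply_le (o : CounterOp) (x : ℤ) : o.rank (o.apply x) ≤ o.rank x := by
  cases o <;> grind [rank, apply]

theorem rank_apply_lt (o : CounterOp) (x : ℤ) (h : ¬ (o.apply x = 0 ↔ x = 0)) :
    o.rank (o.apply x) < o.rank x := by
  cases o <;> grind [rank, apply]

theorem iterate_inc (n : ℕ) (x : ℤ) : inc.apply^[n] x = x + n := by
  induction n with
  | zero => simp
  | succ n ih => rw [Function.iterate_succ_apply', ih]; simp only [apply]; push_cast; ring

theorem iterate_dec (n : ℕ) (x : ℤ) : dec.apply^[n] x = x - n := by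
  induction n with
  | zero => simp
  | succ n ih => rw [Function.iterate_succ_apply', ih]; simp only [apply]; push_cast; ring

theorem iterate_nop (n : ℕ) (x : ℤ) : nop.apply^[n] x = x :=
  Function.iterate_fixed rfl n

theorem iterate_reset (n : ℕ) (x : ℤ) : reset.apply^[n] x = if n = 0 then x else 0 := by
  cases n with
  | zero => simp
  | succ n => rw [Function.iterate_succ_apply']; simp [apply]

theorem isSemilinearSet_iterate_apply_eq (o : CounterOp) :
    IsSemilinearSet {p : ℤ × ℕ × ℤ | o.apply^[p.2.1] p.1 = p.2.2} := by
  let s : ℤ × ℕ × ℤ →+ ℤ := AddMonoidHom.fst _ _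
  let t : ℤ × ℕ × ℤ →+ ℤ := (AddMonoidHom.snd _ _).comp (AddMonoidHom.snd _ _)
  let n : ℤ × ℕ × ℤ →+ ℕ := (AddMonoidHom.fst _ _).comp (AddMonoidHom.snd _ _)
  let n' : ℤ × ℕ × ℤ →+ ℤ := (Nat.castAddMonoidHom ℤ).comp n
  cases o with
  | inc =>
    convert! isSemilinearSet_setOfPred_eq 0 0 (s + n') t using 3 with p
    simp [iterate_inc, s, t, n', n]
  | dec =>
    convert! isSemilinearSet_setOfPred_eq 0 0 s (t + n') using 3 with p
    simp [iterate_dec, s, t, n', n, sub_eq_iff_eq_add]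
  | nop =>
    convert! isSemilinearSet_setOfPred_eq 0 0 s t using 3 with p
    simp [iterate_nop, s, t]
  | reset =>
    have hn := (IsSemilinearSet.singleton (0 : ℕ)).preimage n
    convert! (hn.inter (isSemilinearSet_setOfPred_eq 0 0 s t)).union
      (hn.compl.inter ((IsSemilinearSet.singleton (0 : ℤ)).preimage t)) using 1
    ext p
    by_cases h : p.2.1 = 0 <;> simp [iterate_reset, s, t, n, h, eq_comm]

theorem isSemilinearSet_forall_lt_iterate (o : CounterOp) (b : Bool) :
    IsSemilinearSet {p : ℤ × ℕ | ∀ i < p.2, decide (o.apply^[i] p.1 ≠ 0) = b} := by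
  have hb : IsSemilinearSet {t : ℤ | decide (t ≠ 0) = b}ᶜ := by
    have h0 := IsSemilinearSet.singleton (0 : ℤ)
    cases b with
    | true => convert! h0; ext; simp
    | false => convert! h0.compl; ext; simp
  let f : (ℤ × ℕ × ℤ) × ℕ →+ ℤ :=
    (AddMonoidHom.snd _ _).comp ((AddMonoidHom.snd _ _).comp (AddMonoidHom.fst _ _))
  let g : (ℤ × ℕ × ℤ) × ℕ →+ ℤ × ℕ :=
    { toFun := fun p => (p.1.1, p.1.2.1 + p.2)
      map_zero' := by simp
      map_add' := fun p p' => by ext <;> simp; omega }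
  -- The complement is a projection: some `i` violates the condition and `n = 1 + (i + k)`. The
  -- shift by `(0, 1)` makes `i < n` strict.
  have h := ((((o.isSemilinearSet_iterate_apply_eq.preimage
    (AddMonoidHom.fst _ ℕ)).inter (hb.preimage f)).image g).vadd ((0, 1) : ℤ × ℕ)).compl
  convert! h using 1
  ext ⟨x, n⟩
  rw [Set.mem_compl_iff, ← not_iff_not, not_not]
  constructor
  · intro hx
    simp only [Set.mem_ofPred_eq, not_forall] at hx
    obtain ⟨i, hi, hne⟩ := hx
    refine ⟨(x, n - 1), ⟨((x, i, o.apply^[i] x), n - 1 - i), ⟨rfl, hne⟩, ?_⟩, ?_⟩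
    · ext
      · rfl
      · change i + (n - 1 - i) = n - 1
        omega
    · ext
      · simp
      · simp; omega
  · rintro ⟨_, ⟨⟨⟨s, i, t⟩, k⟩, ⟨h1, h2⟩, rfl⟩, h3⟩ hx
    simp only [Set.mem_ofPred_eq] at hx
    change o.apply^[i] s = t at h1
    change ¬ decide (t ≠ 0) = b at h2
    change ((0 : ℤ) + s, 1 + (i + k)) = (x, n) at h3
    simp only [zero_add, Prod.mk.injEq] at h3
    obtain ⟨rfl, rfl⟩ := h3
    exact h2 (h1 ▸ hx i (by omega))

end CounterOp

section Parikh

variable {α : Type*} [DecidableEq α]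

theorem parikh_append (w w' : List α) : parikh (w ++ w') = parikh w + parikh w' := by
  ext a; simp [parikh]

theorem parikh_replicate (n : ℕ) (a : α) : parikh (List.replicate n a) = Pi.single a n := by
  ext b
  by_cases h : a = b
  · subst h; simp [parikh]
  · simp [parikh, List.count_replicate, h, Ne.symm h]

theorem eq_replicate_of_parikh_eq_single {n : ℕ} {a : α} {w : List α}
    (h : parikh w = Pi.single a n) : w = List.replicate n a := by
  have hmem : ∀ b ∈ w, b = a := by
    intro b hb
    by_contra hne
    have := congrFun h b
    rw [Pi.single_eq_of_ne hne] at this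
    exact absurd hb (List.count_eq_zero.1 this)
  have hlen : w.length = n := by
    have := congrFun h a
    rw [Pi.single_eq_same] at this
    rw [← this]
    exact (List.count_eq_length.2 fun b hb => (hmem b hb).symm).symm
  exact List.eq_replicate_iff.2 ⟨hlen, hmem⟩

end Parikh

/-! ### Deterministic execution and the mask potential -/

namespace SimplifiedMulticounterMachine

variable {Q α : Type*} {d : ℕ} (M : SimplifiedMulticounterMachine Q α d)

/-- The action of a letter on the counters. -/
def act (a : α) (x : Fin d → ℤ) : Fin d → ℤ := fun i => (M.update a i).apply (x i)

/-- The successor configuration. -/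
def next (a : α) (c : Q × (Fin d → ℤ)) : Q × (Fin d → ℤ) :=
  (M.trans c.1 a (counterMask c.2), M.act a c.2)

/-- The configuration reached by reading a word. -/
def exec (w : List α) (c : Q × (Fin d → ℤ)) : Q × (Fin d → ℤ) :=
  w.foldl (fun c a => M.next a c) c

theorem run_iff (w : List α) (c c' : Q × (Fin d → ℤ)) : M.Run w c c' ↔ M.exec w c = c' := by
  induction w generalizing c with
  | nil =>
    constructor
    · rintro ⟨⟩; rfl
    · rintro rfl; exact .nil _
  | cons a w ih =>
    have hs : ∀ e, M.Step a c e ↔ e = M.next a c := fun e => by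
      rw [Prod.ext_iff, funext_iff]; rfl
    constructor
    · rintro (_ | ⟨hstep, hrun⟩)
      rw [hs] at hstep
      subst hstep
      exact (ih _).1 hrun
    · intro h
      exact .cons ((hs _).2 rfl) ((ih _).2 h)

theorem exec_append (w w' : List α) (c : Q × (Fin d → ℤ)) :
    M.exec (w ++ w') c = M.exec w' (M.exec w c) :=
  List.foldl_append

theorem exec_replicate (n : ℕ) (a : α) (c : Q × (Fin d → ℤ)) :
    M.exec (List.replicate n a) c = (M.next a)^[n] c := by
  induction n generalizing c with
  | zero => rfl
  | succ n ih => exact ih _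

theorem act_iterate (a : α) (n : ℕ) (x : Fin d → ℤ) (i : Fin d) :
    (M.act a)^[n] x i = (M.update a i).apply^[n] (x i) := by
  induction n generalizing x with
  | zero => rfl
  | succ n ih => exact ih _

theorem next_iterate_snd (a : α) (n : ℕ) (c : Q × (Fin d → ℤ)) :
    ((M.next a)^[n] c).2 = (M.act a)^[n] c.2 := by
  induction n generalizing c with
  | zero => rfl
  | succ n ih => exact ih _

theorem next_iterate_of_mask_eq (a : α) (m : Fin d → Bool) (n : ℕ) (q : Q) (x : Fin d → ℤ)
    (h : ∀ i < n, counterMask ((M.act a)^[i] x) = m) :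
    (M.next a)^[n] (q, x) = ((fun q => M.trans q a m)^[n] q, (M.act a)^[n] x) := by
  induction n with
  | zero => rfl
  | succ n ih =>
    rw [Function.iterate_succ_apply', ih fun i hi => h i (by omega), next]
    simp only [Function.iterate_succ_apply', h n (by omega)]

/-- The total potential of the counters with respect to a letter. -/
def rank (a : α) (x : Fin d → ℤ) : ℕ := ∑ i, (M.update a i).rank (x i)

theorem rank_le (a : α) (x : Fin d → ℤ) : M.rank a x ≤ d * 2 := by
  simpa [rank] using Finset.sum_le_card_nsmul Finset.univ _ 2 fun i _ => (M.update a i).rank_le_two (x i)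

theorem rank_act_iterate_le (a : α) (n : ℕ) (x : Fin d → ℤ) :
    M.rank a ((M.act a)^[n] x) ≤ M.rank a x := by
  induction n with
  | zero => rfl
  | succ n ih =>
    rw [Function.iterate_succ_apply']
    exact (Finset.sum_le_sum fun i _ => (M.update a i).rank_apply_le _).trans ih

theorem rank_act_lt (a : α) (x : Fin d → ℤ) (h : counterMask (M.act a x) ≠ counterMask x) :
    M.rank a (M.act a x) < M.rank a x := by
  obtain ⟨i, hi⟩ := Function.ne_iff.1 h
  refine Finset.sum_lt_sum (fun i _ => (M.update a i).rank_apply_le _)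
    ⟨i, Finset.mem_univ _, (M.update a i).rank_apply_lt _ fun h' => hi ?_⟩
  simp [counterMask, act, h']

/-! ### Semilinear tracking of runs -/

variable [DecidableEq α]

/-- `M.Tracks T` means that semilinear relations describe, for every `(x, v) ∈ T` and every state,
some run of `M` on a word with Parikh vector `v` that starts with counter values `x`. -/
def Tracks (T : Set ((Fin d → ℤ) × (α → ℕ))) : Prop :=
  ∃ R : Q → Q → Set ((Fin d → ℤ) × (α → ℕ) × (Fin d → ℤ)),
    (∀ q q', IsSemilinearSet (R q q')) ∧
    (∀ q q' x v x', (x, v, x') ∈ R q q' → ∃ w, parikh w = v ∧ M.exec w (q, x) = (q', x')) ∧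
    ∀ q x v, (x, v) ∈ T → ∃ q' x', (x, v, x') ∈ R q q'

variable {M}

theorem Tracks.mono {T T' : Set ((Fin d → ℤ) × (α → ℕ))} (h : M.Tracks T') (hT : T ⊆ T') :
    M.Tracks T := by
  obtain ⟨R, h1, h2, h3⟩ := h
  exact ⟨R, h1, h2, fun q x v hv => h3 q x v (hT hv)⟩

theorem Tracks.union {T T' : Set ((Fin d → ℤ) × (α → ℕ))} (h : M.Tracks T) (h' : M.Tracks T') :
    M.Tracks (T ∪ T') := by
  obtain ⟨R, h1, h2, h3⟩ := h
  obtain ⟨R', h1', h2', h3'⟩ := h'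
  refine ⟨fun q q' => R q q' ∪ R' q q', fun q q' => (h1 q q').union (h1' q q'), ?_, ?_⟩
  · rintro q q' x v x' (h | h)
    exacts [h2 _ _ _ _ _ h, h2' _ _ _ _ _ h]
  · rintro q x v (h | h)
    · obtain ⟨q', x', h⟩ := h3 q x v h
      exact ⟨q', x', .inl h⟩
    · obtain ⟨q', x', h⟩ := h3' q x v h
      exact ⟨q', x', .inr h⟩

theorem Tracks.iUnion {ι : Type*} [Finite ι] {T : ι → Set ((Fin d → ℤ) × (α → ℕ))}
    (h : ∀ i, M.Tracks (T i)) : M.Tracks (⋃ i, T i) := by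
  choose R h1 h2 h3 using h
  refine ⟨fun q q' => ⋃ i, R i q q', fun q q' => .iUnion fun i => h1 i q q', ?_, ?_⟩
  · intro q q' x v x' h
    obtain ⟨i, hi⟩ := Set.mem_iUnion.1 h
    exact h2 i _ _ _ _ _ hi
  · intro q x v h
    obtain ⟨i, hi⟩ := Set.mem_iUnion.1 h
    obtain ⟨q', x', h⟩ := h3 i q x v hi
    exact ⟨q', x', Set.mem_iUnion.2 ⟨i, h⟩⟩

/-- Relational composition is a projection of an intersection of preimages. The condition on `T'`
ranges over all words with Parikh vector `v`, since the first relation only promises some such word.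
-/
theorem Tracks.comp [Finite α] [Finite Q] {T T' : Set ((Fin d → ℤ) × (α → ℕ))}
    (h : M.Tracks T) (h' : M.Tracks T') :
    M.Tracks {p | ∃ v v', p.2 = v + v' ∧ (p.1, v) ∈ T ∧
      ∀ q w, parikh w = v → ((M.exec w (q, p.1)).2, v') ∈ T'} := by
  obtain ⟨R, h1, h2, h3⟩ := h
  obtain ⟨R', h1', h2', h3'⟩ := h'
  let X := Fin d → ℤ
  let A := α → ℕ
  let f : X × A × X × A × X →+ X × A × X :=
    { toFun := fun p => (p.1, p.2.1, p.2.2.1)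
      map_zero' := rfl
      map_add' := fun _ _ => rfl }
  let f' : X × A × X × A × X →+ X × A × X := (AddMonoidHom.snd _ _).comp (AddMonoidHom.snd _ _)
  let g : X × A × X × A × X →+ X × A × X :=
    { toFun := fun p => (p.1, p.2.1 + p.2.2.2.1, p.2.2.2.2)
      map_zero' := by simp
      map_add' := fun p p' => by
        simp only [Prod.fst_add, Prod.snd_add, Prod.mk_add_mk, Prod.mk.injEq, true_and, and_true]
        abel }
  refine ⟨fun q q' => ⋃ e, g '' (f ⁻¹' R q e ∩ f' ⁻¹' R' e q'), fun q q' => .iUnion fun e =>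
    (((h1 q e).preimage f).inter ((h1' e q').preimage f')).image g, ?_, ?_⟩
  · intro q q' x v x' h
    obtain ⟨e, ⟨y, u, z, u', y'⟩, ⟨hr, hr'⟩, heq⟩ := Set.mem_iUnion.1 h
    change (y, u + u', y') = (x, v, x') at heq
    simp only [Prod.mk.injEq] at heq
    obtain ⟨rfl, rfl, rfl⟩ := heq
    obtain ⟨w, rfl, hw⟩ := h2 q e y u z hr
    obtain ⟨w', rfl, hw'⟩ := h2' e q' z u' y' hr'
    exact ⟨w ++ w', parikh_append w w', by rw [exec_append, hw, hw']⟩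
  · rintro q x _ ⟨v, v', rfl, hT, hT'⟩
    obtain ⟨e, z, hr⟩ := h3 q x v hT
    obtain ⟨w, hwv, hw⟩ := h2 _ _ _ _ _ hr
    have hz := hT' q w hwv
    simp only [hw] at hz
    obtain ⟨q', x', hr'⟩ := h3' e z v' hz
    exact ⟨q', x', Set.mem_iUnion.2 ⟨e, (x, v, z, v', x'), ⟨hr, hr'⟩, rfl⟩⟩

/-! ### Phases, blocks and products of blocks -/

variable (M)

theorem tracks_zero [Finite α] : M.Tracks {p | p.2 = 0} := by
  classical
  let X := Fin d → ℤ
  let f : X →+ X × (α → ℕ) × X :=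
    { toFun := fun x => (x, 0, x)
      map_zero' := rfl
      map_add' := fun p p' => by simp }
  refine ⟨fun q q' => if q = q' then f '' Set.univ else ∅, fun q q' => ?_, ?_, ?_⟩
  · dsimp only
    split_ifs
    exacts [IsSemilinearSet.univ.image f, .empty]
  · intro q q' x v x' h
    dsimp only at h
    split_ifs at h with hq
    · obtain ⟨y, -, hy⟩ := h
      change (y, 0, y) = (x, v, x') at hy
      simp only [Prod.mk.injEq] at hy
      obtain ⟨rfl, rfl, rfl⟩ := hy
      exact ⟨[], by ext; simp [parikh], by simp [exec, hq]⟩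
    · exact h.elim
  · rintro q x _ rfl
    exact ⟨q, x, by simpa using! ⟨x, rfl⟩⟩

theorem tracks_constant_mask [Finite Q] (a : α) (m : Fin d → Bool) :
    M.Tracks {p | ∃ n, p.2 = Pi.single a n ∧ ∀ i < n, counterMask ((M.act a)^[i] p.1) = m} := by
  let X := Fin d → ℤ
  let k : X × ℕ × X →+ ℕ := (AddMonoidHom.fst _ _).comp (AddMonoidHom.snd _ _)
  let e : Fin d → X × ℕ × X →+ ℤ × ℕ × ℤ := fun i =>
    { toFun := fun p => (p.1 i, p.2.1, p.2.2 i)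
      map_zero' := rfl
      map_add' := fun _ _ => rfl }
  let e' : Fin d → X × ℕ × X →+ ℤ × ℕ := fun i =>
    { toFun := fun p => (p.1 i, p.2.1)
      map_zero' := rfl
      map_add' := fun _ _ => rfl }
  let g : X × ℕ × X →+ X × (α → ℕ) × X :=
    { toFun := fun p => (p.1, Pi.single a p.2.1, p.2.2)
      map_zero' := by simp
      map_add' := fun p p' => by simp [Pi.single_add] }
  let S : Q → Q → Set (X × ℕ × X) := fun q q' =>
    k ⁻¹' {n | (fun q => M.trans q a m)^[n] q = q'} ∩
      ((⋂ i, e i ⁻¹' {p | (M.update a i).apply^[p.2.1] p.1 = p.2.2}) ∩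
        ⋂ i, e' i ⁻¹' {p | ∀ j < p.2, decide ((M.update a i).apply^[j] p.1 ≠ 0) = m i})
  have hS : ∀ q q' x n x', (x, n, x') ∈ S q q' ↔ (fun q => M.trans q a m)^[n] q = q' ∧
      (M.act a)^[n] x = x' ∧ ∀ j < n, counterMask ((M.act a)^[j] x) = m := by
    intro q q' x n x'
    refine and_congr Iff.rfl (and_congr ?_ ?_)
    · rw [Set.mem_iInter, funext_iff]
      exact forall_congr' fun i => by rw [act_iterate]; rfl
    · rw [Set.mem_iInter]
      constructor
      · intro h j hj
        ext i
        simp only [counterMask, act_iterate]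
        exact h i j hj
      · intro h i j hj
        have := congrFun (h j hj) i
        simp only [counterMask, act_iterate] at this
        exact this
  refine ⟨fun q q' => g '' S q q', fun q q' => .image (.inter
    ((isSemilinearSet_iterate_eq _ q q').preimage k) (.inter
      (.iInter fun i => (CounterOp.isSemilinearSet_iterate_apply_eq _).preimage (e i))
      (.iInter fun i => (CounterOp.isSemilinearSet_forall_lt_iterate _ _).preimage (e' i)))) g,
    ?_, ?_⟩
  · rintro q q' x v x' ⟨⟨y, n, y'⟩, h, heq⟩
    change (y, Pi.single a n, y') = (x, v, x') at heq
    simp only [Prod.mk.injEq] at heq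
    obtain ⟨rfl, rfl, rfl⟩ := heq
    obtain ⟨rfl, rfl, hm⟩ := (hS _ _ _ _ _).1 h
    exact ⟨_, parikh_replicate n a, by rw [exec_replicate, M.next_iterate_of_mask_eq a m n q y hm]⟩
  · rintro q x _ ⟨n, rfl, hm⟩
    exact ⟨_, _, (x, n, _), (hS _ _ _ _ _).2 ⟨rfl, rfl, hm⟩, rfl⟩

/-- Either the mask stays constant, or the block is cut right after the first mask change, where the
rank has dropped and induction applies. -/
theorem tracks_single_of_rank_lt [Finite α] [Finite Q] (a : α) (k : ℕ) :
    M.Tracks {p | M.rank a p.1 < k ∧ ∃ n, p.2 = Pi.single a n} := by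
  induction k with
  | zero => exact M.tracks_zero.mono fun p hp => absurd hp.1 (Nat.not_lt_zero _)
  | succ k ih =>
    have hphase := Tracks.iUnion (M.tracks_constant_mask a)
    refine (hphase.union (hphase.comp ih)).mono ?_
    rintro ⟨x, _⟩ ⟨hk, n, rfl⟩
    by_cases hm : ∀ i < n, counterMask ((M.act a)^[i] x) = counterMask x
    · exact .inl (Set.mem_iUnion.2 ⟨_, n, rfl, hm⟩)
    · right
      have hex : ∃ i, i < n ∧ counterMask ((M.act a)^[i] x) ≠ counterMask x := by
        push Not at hm; exact hm
      classical
      have hspec := Nat.find_spec hex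
      have hmin : ∀ j < Nat.find hex, counterMask ((M.act a)^[j] x) = counterMask x := by
        intro j hj
        by_contra h
        exact Nat.find_min hex hj ⟨hj.trans hspec.1, h⟩
      generalize Nat.find hex = i at hspec hmin
      obtain ⟨hlt, hne⟩ := hspec
      obtain ⟨j, rfl⟩ : ∃ j, i = j + 1 :=
        Nat.exists_eq_succ_of_ne_zero (by rintro rfl; exact hne rfl)
      refine ⟨Pi.single a (j + 1), Pi.single a (n - (j + 1)), ?_, Set.mem_iUnion.2
        ⟨_, j + 1, rfl, hmin⟩, fun q w hw => ⟨?_, _, rfl⟩⟩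
      · rw [← Pi.single_add, Nat.add_sub_cancel' hlt.le]
      · change M.rank a (M.exec w (q, x)).2 < k
        change M.rank a x < k + 1 at hk
        -- A one-letter Parikh vector determines its word, so the quantifier over `w` is harmless.
        rw [eq_replicate_of_parikh_eq_single hw, exec_replicate, next_iterate_snd]
        rw [Function.iterate_succ_apply', ← hmin j (by omega)] at hne
        rw [Function.iterate_succ_apply']
        exact ((M.rank_act_lt a _ hne).trans_le (M.rank_act_iterate_le a j x)).trans_le
          (Nat.le_of_lt_succ hk)

theorem tracks_of_forall_notMem [Finite α] [Finite Q] (s : Finset α) :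
    M.Tracks {p | ∀ a ∉ s, p.2 a = 0} := by
  induction s using Finset.induction_on with
  | empty => exact M.tracks_zero.mono fun p hp => funext fun a => hp a (by simp)
  | insert a s has ih =>
    -- The rank never exceeds `d * 2`, so this bound excludes no counter values.
    refine ((M.tracks_single_of_rank_lt a (d * 2 + 1)).comp ih).mono ?_
    rintro ⟨x, v⟩ hv
    refine ⟨Pi.single a (v a), Function.update v a 0, ?_,
      ⟨Nat.lt_succ_of_le (M.rank_le a x), _, rfl⟩, fun q w _ b hb => ?_⟩
    · ext b
      by_cases h : b = a
      · subst h; simp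
      · simp [h]
    · by_cases h : b = a
      · subst h; simp
      · simpa [h] using! hv b (by simp [h, hb])

end SimplifiedMulticounterMachine

/-! ### Semilinearity of the Parikh image -/

theorem mainTheorem11 {α : Type*} [Finite α] [DecidableEq α] (L : Language α)
    (hperm : PermutationInvariant L)
    {Q : Type*} [Finite Q] {d : ℕ} (M : SimplifiedMulticounterMachine Q α d)
    (hacc : M.acceptedLanguage = L) :
    IsSemilinearSet {v : α → ℕ | ∃ w : List α, w ∈ L ∧ parikh w = v} := by
  have : Fintype α := Fintype.ofFinite α
  obtain ⟨R, hsemi, hsound, htotal⟩ := M.tracks_of_forall_notMem Finset.univ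
  have hmem : ∀ w, w ∈ L ↔ ((M.exec w (M.start, 0)).1, counterMask (M.exec w (M.start, 0)).2) ∈
      M.accept := by
    intro w
    rw [← hacc]
    constructor
    · rintro ⟨q, x, hrun, h⟩
      rw [M.run_iff] at hrun
      change M.exec w (M.start, 0) = _ at hrun
      rwa [hrun]
    · exact fun h => ⟨_, _, (M.run_iff _ _ _).2 rfl, h⟩
  let X := Fin d → ℤ
  let fst : X × (α → ℕ) × X →+ X := AddMonoidHom.fst _ _
  let mid : X × (α → ℕ) × X →+ (α → ℕ) := (AddMonoidHom.fst _ _).comp (AddMonoidHom.snd _ _)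
  let coord : Fin d → X × (α → ℕ) × X →+ ℤ := fun i =>
    (Pi.evalAddMonoidHom _ i).comp ((AddMonoidHom.snd _ _).comp (AddMonoidHom.snd _ _))
  have hmask : ∀ b, IsSemilinearSet {t : ℤ | decide (t ≠ 0) = b} := by
    have h0 := IsSemilinearSet.singleton (0 : ℤ)
    rintro (_ | _)
    · convert! h0; ext; simp
    · convert! h0.compl; ext; simp
  have h := IsSemilinearSet.iUnion fun c : M.accept => (((hsemi M.start c.1.1).inter
    ((IsSemilinearSet.singleton 0).preimage fst)).inter
      (.iInter fun i => (hmask (c.1.2 i)).preimage (coord i))).image mid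
  convert! h using 1
  ext v
  rw [Set.mem_iUnion]
  constructor
  · rintro ⟨w, hw, rfl⟩
    obtain ⟨q, x, hr⟩ := htotal M.start 0 (parikh w) (by simp)
    obtain ⟨w', hpar, hexec⟩ := hsound _ _ _ _ _ hr
    -- The tracked word `w'` may differ from `w`; permutation invariance transfers membership to it.
    have hw' := (hmem w').1 ((hperm w' w hpar).2 hw)
    rw [hexec] at hw'
    exact ⟨⟨_, hw'⟩, (0, parikh w, x), ⟨⟨hr, rfl⟩, Set.mem_iInter.2 fun i => rfl⟩, rfl⟩
  · rintro ⟨⟨⟨q, m⟩, hacc'⟩, ⟨x, u, y⟩, ⟨⟨hr, hx⟩, hy⟩, rfl⟩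
    change x = 0 at hx
    subst hx
    obtain ⟨w, rfl, hexec⟩ := hsound _ _ _ _ _ hr
    refine ⟨w, (hmem w).2 ?_, rfl⟩
    have hm : counterMask y = m := funext fun i => Set.mem_iInter.1 hy i
    rwa [hexec, hm]
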